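/- Let $q$ be a prime power and let $C\subseteq\mathbb{F}_{q^2}^n$ be a cyclic linear code with parameters $[n,k,d]_{q^2}$ (dimension $k$; minimum distance $d$, the least Hamming distance between two distinct codewords, so $C\neq 0$). Let $C^{\perp_h}=\{x\in\mathbb{F}_{q^2}^n : \sum_{i} x_i y_i^{q}=0 \text{ for all } y\in C\}$ be its Hermitian dual, and suppose that $C$ is LCD with respect to the Hermitian form, i.e. $C\cap C^{\perp_h}=\{0\}$. Then there is a maximal-entanglement entanglement-assisted quantum (QUENTA) code with parameters $[[n,k,d;n-k]]_q$. Here an entanglement-assisted quantum code $[[n,k,d;c]]_q$ is given by an isometry $W:(\mathbb{C}^q)^{\otimes k}\otimes(\mathbb{C}^q)^{\otimes c}\to(\mathbb{C}^q)^{\otimes n}$ and encodes a state $\varphi$ of $k$ logical qudits as $\widehat\varphi=(W\otimes I)(\varphi\otimes\Phi)$, where $\Phi=q^{-c/2}\sum_{a}|a\rangle\otimes|a\rangle$, the sum being over the computational basis of $(\mathbb{C}^q)^{\otimes c}$, is the state of $c$ maximally entangled pairs shared by sender and receiver, and $W$ acts on the logical qudits and the sender's halves. Its minimum distance is $d$: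 every operator $E$ acting on fewer than $d$ of the $n$ channel qudits is detected, i.e. there is $\mu\in\mathbb{C}$ with $\langle\widehat\varphi,(E\otimes I)\widehat\psi\rangle=\mu\langle\varphi,\psi\rangle$ for all $\varphi,\psi$, and some operator acting on $d$ channel qudits is not detected. The code has maximal entanglement if $c=n-k$. -/

import Mathlib

open scoped Matrix Kronecker

noncomputable section

/-! ### Classical linear codes -/

/-- The linear code `C` has minimum distance `d`: `d` is the least Hamming distance between two
distinct codewords. (This forces `C` to be nonzero.) -/
def HasMinDistance {F : Type*} [Field F] [DecidableEq F] {n : ℕ}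
    (C : Submodule F (Fin n → F)) (d : ℕ) : Prop :=
  IsLeast {w : ℕ | ∃ x ∈ C, ∃ y ∈ C, x ≠ y ∧ hammingDist x y = w} d

/-- `C` is an `[n, k, d]` linear code over `F`. -/
def HasParameters {F : Type*} [Field F] [DecidableEq F] {n : ℕ}
    (C : Submodule F (Fin n → F)) (k d : ℕ) : Prop :=
  Module.finrank F C = k ∧ HasMinDistance C d

/-- `C` is cyclic: `(c₀, …, cₙ₋₁) ∈ C` implies `(cₙ₋₁, c₀, …, cₙ₋₂) ∈ C`. -/
def IsCyclicCode {F : Type*} [Field F] {n : ℕ} (C : Submodule F (Fin n → F)) : Prop :=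
  ∀ c ∈ C, (fun i => c ((finRotate n).symm i)) ∈ C

/-- The Hermitian dual of a code over a field with `q ^ 2` elements:
all `x` with `∑ i, x i * (y i) ^ q = 0` for every codeword `y`. -/
def hermitianDual {F : Type*} [Field F] {n : ℕ} (q : ℕ) (C : Submodule F (Fin n → F)) :
    Submodule F (Fin n → F) where
  carrier := {x | ∀ y ∈ C, ∑ i, x i * (y i) ^ q = 0}
  zero_mem' := by intro y _; simp
  add_mem' := by
    intro a b ha hb y hy
    have h1 := ha y hy
    have h2 := hb y hy
    simp [add_mul, Finset.sum_add_distrib, h1, h2]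
  smul_mem' := by
    intro r a ha y hy
    have h1 := ha y hy
    simp [mul_assoc, ← Finset.mul_sum, h1]

/-- `C` is LCD (linear complementary dual) with respect to the Hermitian form. -/
def IsHermitianLCD {F : Type*} [Field F] {n : ℕ} (q : ℕ) (C : Submodule F (Fin n → F)) : Prop :=
  C ⊓ hermitianDual q C = ⊥

/-! ### Entanglement-assisted quantum codes

The state space of `m` qudits of dimension `q` has the orthonormal computational basis indexed by
`Fin m → Fin q`; a vector is its family of coordinates, an operator its matrix. -/

/-- The state of `c` maximally entangled pairs,
`q ^ (-c / 2) * ∑ a, |a⟩ ⊗ |a⟩`; first factor: sender, second factor: receiver. -/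
def maxEntangledState (q c : ℕ) : (Fin c → Fin q) × (Fin c → Fin q) → ℂ :=
  fun p => if p.1 = p.2 then ((Real.sqrt ((q : ℝ) ^ c))⁻¹ : ℂ) else 0

/-- An entanglement-assisted quantum code encoding `k` logical qudits into `n` physical qudits of
dimension `q` with `c` maximally entangled pairs. It is given by the sender's encoding isometry,
from the `k` logical qudits and the sender's halves of the `c` pairs to the `n` qudits sent through
the channel. (Equivalently: a unitary on `n` qudits after adjoining `n - k - c` ancillas in a fixed
basis state.) -/
structure EAQuantumCode (q n k c : ℕ) where
  enc : Matrix (Fin n → Fin q) ((Fin k → Fin q) × (Fin c → Fin q)) ℂ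
  enc_isometry : encᴴ * enc = 1

/-- The encoding `φ ↦ (enc ⊗ 1) (φ ⊗ Φ)`, where `Φ` is the state of `c` maximally entangled pairs.
The result is a state of the `n` channel qudits and the `c` qudits kept by the receiver. -/
def EAQuantumCode.encode {q n k c : ℕ} (Q : EAQuantumCode q n k c) (φ : (Fin k → Fin q) → ℂ) :
    (Fin n → Fin q) × (Fin c → Fin q) → ℂ :=
  (Q.enc ⊗ₖ (1 : Matrix (Fin c → Fin q) (Fin c → Fin q) ℂ)) *ᵥ
    fun p => φ p.1.1 * maxEntangledState q c (p.1.2, p.2)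

/-- The operator `E` on `n` qudits acts only on the qudits in `S`: it is `A ⊗ 1` for an operator
`A` on the qudits in `S`. -/
def ActsOnlyOn {q n : ℕ} (E : Matrix (Fin n → Fin q) (Fin n → Fin q) ℂ) (S : Finset (Fin n)) :
    Prop :=
  ∃ A : Matrix (S → Fin q) (S → Fin q) ℂ, ∀ x y : Fin n → Fin q,
    E x y = if ∀ i, i ∉ S → x i = y i then A (fun i => x i) (fun i => y i) else 0

/-- The code detects the error `E` on the channel qudits (the receiver's halves of the entangled
pairs are error-free): the compression of `E ⊗ 1` to the code space is a scalar,
`⟨encode φ, (E ⊗ 1) encode ψ⟩ = μ * ⟨φ, ψ⟩`. -/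
def EAQuantumCode.Detects {q n k c : ℕ} (Q : EAQuantumCode q n k c)
    (E : Matrix (Fin n → Fin q) (Fin n → Fin q) ℂ) : Prop :=
  ∃ μ : ℂ, ∀ φ ψ : (Fin k → Fin q) → ℂ,
    star (Q.encode φ) ⬝ᵥ
      ((E ⊗ₖ (1 : Matrix (Fin c → Fin q) (Fin c → Fin q) ℂ)) *ᵥ Q.encode ψ) =
      μ * (star φ ⬝ᵥ ψ)

/-- The code has minimum distance `d`: every error on fewer than `d` channel qudits is detected,
and some error on `d` channel qudits is not. -/
def EAQuantumCode.HasMinDistance {q n k c : ℕ} (Q : EAQuantumCode q n k c) (d : ℕ) : Prop :=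
  IsLeast {w : ℕ | ∃ S : Finset (Fin n), S.card = w ∧
    ∃ E : Matrix (Fin n → Fin q) (Fin n → Fin q) ℂ, ActsOnlyOn E S ∧ ¬ Q.Detects E} d

/-- A code with maximal entanglement uses `c = n - k` maximally entangled pairs. -/
def EAQuantumCode.IsMaximalEntanglement {q n k c : ℕ} (_Q : EAQuantumCode q n k c) : Prop :=
  k + c = n

end

noncomputable section

/-! ### Joint eigenvectors -/

/-! The LCD condition says that the Hermitian form is nondegenerate on `C`. Since every nonzero
fixed element of `σ = (· ^ q)` is a norm, `C` and its orthogonal complement have orthonormal bases,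
which together form a unitary map `U : F^k × F^c → F^n` with `U (F^k × 0) = C` and `k + c = n`
(`exists_unitary_splitting`).

Vectors over `F` label Weyl operators on qudits, whose commutation phases depend only on the
antisymmetrised Hermitian form. So the operators of `U (a, b)` on `n` qudits and those of `(a, b)`
on `k + c` qudits obey the same relations. As the latter are irreducible, a finite Stone–von Neumann
argument (`exists_isometric_intertwiner`) gives an isometry `W` intertwining the two families up to
phases. This is the encoder.

An error `E` is detected iff the partial trace of `Wᴴ E W` over the sender's halves is scalar
(`detects_iff`). For the Weyl operator of a nonzero codeword `U (a, 0)` it is a nonzero multiple of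
the Weyl operator of `a`, hence not scalar. Conversely, let `E` act on a set `S` supporting no
nonzero codeword. By duality each `a` has a `b` with `U (a, b)` vanishing on `S`
(`exists_extension_vanishing`). Then `E` commutes with the Weyl operator of `U (a, b)`, so the
partial trace commutes with that of every `a` and is scalar by Schur's lemma. Thus the quantum
distance is the least weight of a nonzero codeword. -/

theorem exists_joint_eigenvector {ι M : Type*} [Finite ι] [AddCommGroup M] [Module ℂ M]
    [FiniteDimensional ℂ M] [Nontrivial M] (f : ι → Module.End ℂ M)
    (hf : ∀ i j x, f i (f j x) = f j (f i x)) :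
    ∃ x : M, x ≠ 0 ∧ ∃ χ : ι → ℂ, ∀ i, f i x = χ i • x := by
  classical
  have := Fintype.ofFinite ι
  suffices h : ∀ s : Finset ι, ∃ x : M, x ≠ 0 ∧ ∃ χ : ι → ℂ, ∀ i ∈ s, f i x = χ i • x by
    simpa using h Finset.univ
  intro s
  induction s using Finset.induction_on with
  | empty =>
    obtain ⟨x, hx⟩ := exists_ne (0 : M)
    exact ⟨x, hx, 0, by simp⟩
  | insert j s hj ih =>
    obtain ⟨x, hx, χ, hχ⟩ := ih
    -- The joint eigenspace for `s` is nonzero and, by commutation, stable under `f j`, which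
    -- therefore has an eigenvector inside it.
    let P : Submodule ℂ M := ⨅ i ∈ s, (f i).eigenspace (χ i)
    have hP : ∀ y, y ∈ P ↔ ∀ i ∈ s, f i y = χ i • y := fun y => by
      simp [P, Submodule.mem_iInf]
    have hinv : ∀ y ∈ P, f j y ∈ P := fun y hy => by
      rw [hP] at hy ⊢
      intro i hi
      rw [hf, hy i hi, map_smul]
    have : Nontrivial P := ⟨⟨x, (hP x).2 hχ⟩, 0, fun h => hx (by simpa using congrArg Subtype.val h)⟩
    obtain ⟨c, hc⟩ := Module.End.exists_eigenvalue ((f j).restrict hinv)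
    obtain ⟨y, hy⟩ := hc.exists_hasEigenvector
    refine ⟨y, fun h => hy.2 (Subtype.ext h), Function.update χ j c, fun i hi => ?_⟩
    rcases Finset.mem_insert.1 hi with rfl | hi
    · simpa using congrArg Subtype.val hy.apply_eq_smul
    · rw [Function.update_of_ne (ne_of_mem_of_not_mem hi hj)]
      exact (hP _).1 y.2 i hi

/-! ### Weyl operators -/

section Weyl

variable {ι K Q : Type*} [Field K] (e : Q ≃ K)

/-- Translation of the labels of basis states. -/
def labelShift (a : ι → K) (x : ι → Q) : ι → Q := fun i => e.symm (e (x i) + a i)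

theorem labelShift_labelShift (a b : ι → K) (x : ι → Q) :
    labelShift e a (labelShift e b x) = labelShift e (a + b) x := by
  funext i
  simp [labelShift, add_assoc, add_comm (b i)]

@[simp]
theorem labelShift_zero (x : ι → Q) : labelShift e 0 x = x := by
  funext i
  simp [labelShift]

theorem labelShift_eq_iff (a : ι → K) (x y : ι → Q) :
    x = labelShift e a y ↔ labelShift e (-a) x = y := by
  constructor
  · rintro rfl
    simp [labelShift_labelShift]
  · rintro rfl
    simp [labelShift_labelShift]

theorem labelShift_injective (a : ι → K) : Function.Injective (labelShift e a : (ι → Q) → ι → Q) :=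
  fun x y h => by
    rw [labelShift_eq_iff] at h
    simpa [labelShift_labelShift] using h

/-- The character of labels given by `b`. -/
def labelChar [Fintype ι] (ψ : AddChar K ℂ) (b : ι → K) (x : ι → Q) : ℂ := ψ (∑ i, b i * e (x i))

variable [Fintype ι] (ψ : AddChar K ℂ)

theorem labelChar_labelShift (a b : ι → K) (x : ι → Q) :
    labelChar e ψ b (labelShift e a x) = ψ (b ⬝ᵥ a) * labelChar e ψ b x := by
  simp [labelChar, labelShift, mul_add, Finset.sum_add_distrib, AddChar.map_add_eq_mul, dotProduct,
    mul_comm]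

@[simp]
theorem labelChar_zero (x : ι → Q) : labelChar e ψ 0 x = 1 := by
  simp [labelChar]

theorem labelChar_mul (b b' : ι → K) (x : ι → Q) :
    labelChar e ψ b x * labelChar e ψ b' x = labelChar e ψ (b + b') x := by
  simp [labelChar, add_mul, Finset.sum_add_distrib, AddChar.map_add_eq_mul]

theorem star_labelChar_mul_self [Finite K] (b : ι → K) (x : ι → Q) :
    star (labelChar e ψ b x) * labelChar e ψ b x = 1 := by
  have h : ‖labelChar e ψ b x‖ = 1 := AddChar.norm_apply ψ _
  rw [← starRingEnd_apply, Complex.conj_mul', h]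
  simp

theorem exists_labelChar_ne {ψ : AddChar K ℂ} (hψ : ψ.IsPrimitive) [DecidableEq ι] {x y : ι → Q}
    (h : x ≠ y) : ∃ b, labelChar e ψ b x ≠ labelChar e ψ b y := by
  obtain ⟨i, hi⟩ := Function.ne_iff.1 h
  have hi' : e (x i) - e (y i) ≠ 0 := fun h0 => hi (e.injective (sub_eq_zero.1 h0))
  obtain ⟨t, ht⟩ := DFunLike.ne_iff.1 (hψ hi')
  refine ⟨Pi.single i t, fun hxy => ht ?_⟩
  simp only [labelChar, Pi.single_apply, ite_mul, zero_mul, Finset.sum_ite_eq', Finset.mem_univ,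
    if_true] at hxy
  rw [AddChar.mulShift_apply, AddChar.one_apply, sub_mul, mul_comm _ t, mul_comm _ t,
    AddChar.map_sub_eq_div, hxy, div_self]
  exact (AddChar.val_isUnit ψ _).ne_zero

variable [DecidableEq Q]

/-- The Weyl operator `|y⟩ ↦ ψ (b · y) |y + a⟩`. -/
def weyl (a b : ι → K) : Matrix (ι → Q) (ι → Q) ℂ :=
  Matrix.of fun x y => if x = labelShift e a y then labelChar e ψ b y else 0

theorem weyl_apply (a b : ι → K) (x y : ι → Q) :
    weyl e ψ a b x y = if x = labelShift e a y then labelChar e ψ b y else 0 := rfl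

@[simp]
theorem weyl_zero : weyl e ψ (0 : ι → K) 0 = 1 := by
  ext x y
  simp [weyl_apply, Matrix.one_apply]

variable [Fintype Q] [DecidableEq ι]

theorem mul_weyl_apply {X : Type*} (M : Matrix X (ι → Q) ℂ) (a b : ι → K) (x : X) (y : ι → Q) :
    (M * weyl e ψ a b) x y = M x (labelShift e a y) * labelChar e ψ b y := by
  simp [Matrix.mul_apply, weyl_apply]

theorem weyl_mul_apply {X : Type*} (M : Matrix (ι → Q) X ℂ) (a b : ι → K) (x : ι → Q) (y : X) :
    (weyl e ψ a b * M) x y =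
      labelChar e ψ b (labelShift e (-a) x) * M (labelShift e (-a) x) y := by
  simp [Matrix.mul_apply, weyl_apply, labelShift_eq_iff]

theorem weyl_mul_weyl (a b a' b' : ι → K) :
    weyl e ψ a b * weyl e ψ a' b' = ψ (b ⬝ᵥ a') • weyl e ψ (a + a') (b + b') := by
  ext x y
  rw [mul_weyl_apply, weyl_apply, labelShift_labelShift, Matrix.smul_apply, weyl_apply,
    labelChar_labelShift, ← labelChar_mul]
  split_ifs <;> simp [mul_assoc]

theorem weyl_comm (a b a' b' : ι → K) :
    weyl e ψ a b * weyl e ψ a' b' =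
      ψ (b ⬝ᵥ a' - b' ⬝ᵥ a) • (weyl e ψ a' b' * weyl e ψ a b) := by
  rw [weyl_mul_weyl, weyl_mul_weyl, smul_smul, ← AddChar.map_add_eq_mul, sub_add_cancel,
    add_comm a, add_comm b]

theorem conjTranspose_weyl_mul_weyl [Finite K] (a b : ι → K) :
    (weyl e ψ a b)ᴴ * weyl e ψ a b = 1 := by
  ext x y
  rw [mul_weyl_apply, Matrix.conjTranspose_apply, weyl_apply, Matrix.one_apply]
  simp only [(labelShift_injective e a).eq_iff]
  by_cases h : x = y
  · subst h
    simpa using star_labelChar_mul_self e ψ b x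
  · simp [h, Ne.symm h]

/-- The commutant of the Weyl operators consists of scalars. -/
theorem eq_smul_one_of_commute_weyl {ψ : AddChar K ℂ} (hψ : ψ.IsPrimitive)
    (P : Matrix (ι → Q) (ι → Q) ℂ)
    (hP : ∀ a b, P * weyl e ψ a b = weyl e ψ a b * P) : ∃ μ : ℂ, P = μ • 1 := by
  let x₀ : ι → Q := fun _ => e.symm 0
  refine ⟨P x₀ x₀, ?_⟩
  ext x y
  by_cases hxy : x = y
  · subst hxy
    -- The shift carrying `x₀` to `x` equates the two diagonal entries; below, a diagonal Weyl
    -- operator separating `x` from `y` kills the off-diagonal entry.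
    have h := congrFun (congrFun (hP (fun i => e (x i)) 0) x) x₀
    have h1 : labelShift e (fun i => e (x i)) x₀ = x := by
      funext i
      simp [labelShift, x₀]
    have h2 : labelShift e (-fun i => e (x i)) x = x₀ := by
      rw [← labelShift_eq_iff, h1]
    rw [mul_weyl_apply, weyl_mul_apply, h1, h2] at h
    simpa using h
  · obtain ⟨b, hb⟩ := exists_labelChar_ne e hψ hxy
    have h := congrFun (congrFun (hP 0 b) x) y
    rw [mul_weyl_apply, weyl_mul_apply, neg_zero, labelShift_zero, labelShift_zero] at h
    have : (labelChar e ψ b x - labelChar e ψ b y) * P x y = 0 := by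
      linear_combination -h
    simpa [hxy, sub_eq_zero, hb] using this

/-- Commutation with operators on the first factor makes each block `P (·, s) (·, t)` a scalar `L s
t`; commutation with operators on the second factor then makes `L` scalar. -/
theorem eq_smul_one_of_commute_weyl_kronecker {ψ : AddChar K ℂ} (hψ : ψ.IsPrimitive)
    {κ : Type*} [Fintype κ] [DecidableEq κ]
    (P : Matrix ((ι → Q) × (κ → Q)) ((ι → Q) × (κ → Q)) ℂ)
    (hP : ∀ (a b : ι → K) (a' b' : κ → K), P * (weyl e ψ a b ⊗ₖ weyl e ψ a' b') =
      (weyl e ψ a b ⊗ₖ weyl e ψ a' b') * P) : ∃ μ : ℂ, P = μ • 1 := by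
  have h1 : ∀ s t, ∃ μ : ℂ, (Matrix.of fun x y => P (x, s) (y, t)) = μ • 1 := by
    intro s t
    refine eq_smul_one_of_commute_weyl e hψ _ fun a b => ?_
    ext x y
    have h := congrFun (congrFun (hP a b 0 0) (x, s)) (y, t)
    simpa [Matrix.mul_apply, Fintype.sum_prod_type, Matrix.kroneckerMap_apply, Matrix.one_apply]
      using h
  choose L hL using h1
  have hL' : ∀ x y s t, P (x, s) (y, t) = L s t * if x = y then 1 else 0 := fun x y s t => by
    simpa [Matrix.one_apply] using congrFun (congrFun (hL s t) x) y
  obtain ⟨μ, hμ⟩ : ∃ μ : ℂ, Matrix.of L = μ • 1 := by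
    refine eq_smul_one_of_commute_weyl e hψ _ fun a b => ?_
    ext s t
    let x : ι → Q := fun _ => e.symm 0
    have h := congrFun (congrFun (hP 0 0 a b) (x, s)) (x, t)
    simpa [Matrix.mul_apply, Fintype.sum_prod_type, Matrix.kroneckerMap_apply, Matrix.one_apply,
      hL'] using h
  refine ⟨μ, ?_⟩
  ext ⟨x, s⟩ ⟨y, t⟩
  have h := congrFun (congrFun hμ s) t
  simp only [Matrix.of_apply, Matrix.smul_apply, Matrix.one_apply, smul_eq_mul] at h
  rw [hL', h]
  by_cases hx : x = y <;> by_cases hs : s = t <;> simp [hx, hs]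

end Weyl

/-! ### Intertwiners of projective unitary representations -/

section Intertwiner

variable {V X Y : Type*} [Fintype X] [Fintype Y] [DecidableEq X] [DecidableEq Y]

/-- Two families of unitary matrices with the same commutation relations, the second one
irreducible, are related by an isometry, up to phases. -/
theorem exists_isometric_intertwiner [Finite V] [Nonempty X] [Nonempty Y]
    (E : V → Matrix X X ℂ) (F : V → Matrix Y Y ℂ) (ω : V → V → ℂ)
    (hE : ∀ v, (E v)ᴴ * E v = 1) (hF : ∀ v, (F v)ᴴ * F v = 1)
    (hω : ∀ v w, star (ω v w) * ω v w = 1)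
    (hEE : ∀ v w, E v * E w = ω v w • (E w * E v))
    (hFF : ∀ v w, F v * F w = ω v w • (F w * F v))
    (hirr : ∀ P : Matrix Y Y ℂ, (∀ v, P * F v = F v * P) → ∃ μ : ℂ, P = μ • 1) :
    ∃ W : Matrix X Y ℂ, Wᴴ * W = 1 ∧
      ∀ v, ∃ θ : ℂ, star θ * θ = 1 ∧ E v * W = θ • (W * F v) := by
  have hF' : ∀ v, F v * (F v)ᴴ = 1 := fun v => mul_eq_one_comm.1 (hF v)
  -- These maps commute because the phase `ω` from the left cancels its conjugate from the right. A
  -- joint eigenvector is an intertwiner up to scalars.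
  let f : V → Module.End ℂ (Matrix X Y ℂ) := fun v =>
    { toFun := fun T => E v * T * (F v)ᴴ
      map_add' := fun S T => by simp [Matrix.mul_add, Matrix.add_mul]
      map_smul' := fun c T => by simp }
  have hf : ∀ v w T, f v (f w T) = f w (f v T) := fun v w T => by
    change E v * (E w * T * (F w)ᴴ) * (F v)ᴴ = E w * (E v * T * (F v)ᴴ) * (F w)ᴴ
    calc E v * (E w * T * (F w)ᴴ) * (F v)ᴴ = (E v * E w) * T * (F v * F w)ᴴ := by
          simp only [Matrix.mul_assoc, Matrix.conjTranspose_mul]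
      _ = (star (ω v w) * ω v w) • ((E w * E v) * T * (F w * F v)ᴴ) := by
          rw [hEE, hFF, Matrix.conjTranspose_smul, Matrix.smul_mul, Matrix.smul_mul,
            Matrix.mul_smul, smul_smul, mul_comm]
      _ = _ := by
          rw [hω, one_smul]
          simp only [Matrix.mul_assoc, Matrix.conjTranspose_mul]
  obtain ⟨T, hT0, χ, hχ⟩ := exists_joint_eigenvector f hf
  have hχ' : ∀ v, E v * T = χ v • (T * F v) := fun v => by
    have h : E v * T * (F v)ᴴ = χ v • T := hχ v
    rw [← Matrix.smul_mul, ← h, Matrix.mul_assoc, hF, Matrix.mul_one]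
  have htr : (Tᴴ * T).trace ≠ 0 := by
    open scoped ComplexOrder in
    rwa [Ne, Matrix.trace_conjTranspose_mul_self_eq_zero_iff]
  have hP : ∀ v, Tᴴ * T = (star (χ v) * χ v) • ((F v)ᴴ * (Tᴴ * T) * F v) := fun v => by
    calc Tᴴ * T = (E v * T)ᴴ * (E v * T) := by
          rw [Matrix.conjTranspose_mul, Matrix.mul_assoc, ← Matrix.mul_assoc _ (E v), hE,
            Matrix.one_mul]
      _ = _ := by
          rw [hχ', Matrix.conjTranspose_smul, Matrix.smul_mul, Matrix.mul_smul, smul_smul,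
            Matrix.conjTranspose_mul]
          simp only [Matrix.mul_assoc]
  -- Traces in `hP` force unit modulus, so `Tᴴ * T` commutes with every `F v`.
  have hχ1 : ∀ v, star (χ v) * χ v = 1 := fun v => by
    have h := congrArg Matrix.trace (hP v)
    rw [Matrix.trace_smul, Matrix.trace_mul_cycle, hF', Matrix.one_mul, smul_eq_mul] at h
    exact mul_right_cancel₀ htr (by rw [one_mul]; exact h.symm)
  obtain ⟨μ, hμ⟩ := hirr (Tᴴ * T) fun v => by
    conv_rhs => rw [hP v, hχ1, one_smul, ← Matrix.mul_assoc, ← Matrix.mul_assoc, hF',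
      Matrix.one_mul]
  have hμ0 : μ ≠ 0 := fun h => htr (by simp [hμ, h])
  obtain ⟨y⟩ := ‹Nonempty Y›
  -- The scalar is the squared norm of a column of `T`, so dividing `T` by its square root yields an
  -- isometry.
  obtain ⟨r, hr0, hr⟩ : ∃ r : ℝ, 0 ≤ r ∧ μ = r := by
    refine ⟨∑ x, ‖T x y‖ ^ 2, by positivity, ?_⟩
    have h := congrFun (congrFun hμ y) y
    simp only [Matrix.mul_apply, Matrix.conjTranspose_apply, Matrix.smul_apply,
      Matrix.one_apply_eq, smul_eq_mul, mul_one] at h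
    rw [← h]
    push_cast
    exact Finset.sum_congr rfl fun x _ => by rw [← starRingEnd_apply, Complex.conj_mul']
  subst hr
  have hs : star (((Real.sqrt r)⁻¹ : ℝ) : ℂ) = ((Real.sqrt r)⁻¹ : ℝ) := Complex.conj_ofReal _
  refine ⟨(((Real.sqrt r)⁻¹ : ℝ) : ℂ) • T, ?_, fun v => ⟨χ v, hχ1 v, ?_⟩⟩
  · rw [Matrix.conjTranspose_smul, Matrix.smul_mul, Matrix.mul_smul, hμ, smul_smul, smul_smul, hs,
      ← Complex.ofReal_mul, ← Complex.ofReal_mul, ← mul_inv, Real.mul_self_sqrt hr0,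
      inv_mul_cancel₀ (by exact_mod_cast hμ0), Complex.ofReal_one, one_smul]
  · rw [Matrix.mul_smul, hχ', Matrix.smul_mul, smul_comm]

/-- Compression along an intertwiner preserves commutation. -/
theorem commute_compression {W : Matrix X Y ℂ} {E M : Matrix X X ℂ} {F : Matrix Y Y ℂ} {θ : ℂ}
    (hE : Eᴴ * E = 1) (hF : Fᴴ * F = 1) (hθ : star θ * θ = 1) (hW : E * W = θ • (W * F))
    (hM : M * E = E * M) : (Wᴴ * M * W) * F = F * (Wᴴ * M * W) := by
  have hE' : E * Eᴴ = 1 := mul_eq_one_comm.1 hE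
  have hF' : F * Fᴴ = 1 := mul_eq_one_comm.1 hF
  have h1 : W * F = star θ • (E * W) := by rw [hW, smul_smul, hθ, one_smul]
  have h2 : W * Fᴴ = θ • (Eᴴ * W) := by
    calc W * Fᴴ = Eᴴ * (E * W) * Fᴴ := by rw [← Matrix.mul_assoc, hE, Matrix.one_mul]
      _ = θ • (Eᴴ * W) := by
        rw [hW, Matrix.mul_smul, Matrix.smul_mul, Matrix.mul_assoc, Matrix.mul_assoc, hF',
          Matrix.mul_one]
  have h3 : F * Wᴴ = star θ • (Wᴴ * E) := by
    simpa using congrArg Matrix.conjTranspose h2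
  rw [Matrix.mul_assoc, h1, Matrix.mul_smul, ← Matrix.mul_assoc, Matrix.mul_assoc Wᴴ M E, hM,
    ← Matrix.mul_assoc, ← Matrix.mul_assoc, ← Matrix.mul_assoc, h3, Matrix.smul_mul,
    Matrix.smul_mul]

end Intertwiner

/-! ### Partial trace -/

section PartialTrace

variable {X Y : Type*} [Fintype X] [Fintype Y]

/-- The partial trace over the second factor. -/
def partialTrace {X Y : Type*} [Fintype Y] (M : Matrix (X × Y) (X × Y) ℂ) : Matrix X X ℂ :=
  Matrix.of fun x x' => ∑ y, M (x, y) (x', y)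

theorem partialTrace_mul_kronecker_one [DecidableEq Y]
    (M : Matrix (X × Y) (X × Y) ℂ) (A : Matrix X X ℂ) :
    partialTrace (M * (A ⊗ₖ (1 : Matrix Y Y ℂ))) = partialTrace M * A := by
  ext x x'
  simp only [partialTrace, Matrix.of_apply, Matrix.mul_apply, Fintype.sum_prod_type,
    Matrix.kroneckerMap_apply, Matrix.one_apply, mul_ite, mul_one, mul_zero, Finset.sum_ite_eq',
    Finset.mem_univ, if_true, Finset.sum_mul]
  exact Finset.sum_comm

theorem partialTrace_kronecker_one_mul [DecidableEq Y]
    (M : Matrix (X × Y) (X × Y) ℂ) (A : Matrix X X ℂ) :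
    partialTrace ((A ⊗ₖ (1 : Matrix Y Y ℂ)) * M) = A * partialTrace M := by
  ext x x'
  simp only [partialTrace, Matrix.of_apply, Matrix.mul_apply, Fintype.sum_prod_type,
    Matrix.kroneckerMap_apply, Matrix.one_apply, mul_ite, mul_one, mul_zero, ite_mul, zero_mul,
    Finset.sum_ite_eq, Finset.mem_univ, if_true, Finset.mul_sum]
  exact Finset.sum_comm

theorem partialTrace_one_kronecker_mul [DecidableEq X]
    (M : Matrix (X × Y) (X × Y) ℂ) (B : Matrix Y Y ℂ) :
    partialTrace (((1 : Matrix X X ℂ) ⊗ₖ B) * M) =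
      partialTrace (M * ((1 : Matrix X X ℂ) ⊗ₖ B)) := by
  ext x x'
  simp only [partialTrace, Matrix.of_apply, Matrix.mul_apply, Fintype.sum_prod_type_right,
    Matrix.kroneckerMap_apply, Matrix.one_apply, mul_ite, mul_zero, ite_mul, zero_mul, one_mul,
    Finset.sum_ite_eq, Finset.sum_ite_eq', Finset.mem_univ, if_true]
  rw [Finset.sum_comm]
  simp only [mul_comm]

theorem partialTrace_kronecker {X Y : Type*} [Fintype Y] (A : Matrix X X ℂ) (B : Matrix Y Y ℂ) :
    partialTrace (A ⊗ₖ B) = B.trace • A := by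
  ext x x'
  simp [partialTrace, Matrix.trace, Finset.sum_mul, mul_comm (A x x')]

theorem partialTrace_smul {X Y : Type*} [Fintype Y] (c : ℂ) (M : Matrix (X × Y) (X × Y) ℂ) :
    partialTrace (c • M) = c • partialTrace M := by
  ext x x'
  simp [partialTrace, Finset.mul_sum]

/-- The partial trace is cyclic for operators on the traced factor, so the unitary `B` cancels
against its adjoint. -/
theorem partialTrace_commute [DecidableEq X] [DecidableEq Y]
    {M : Matrix (X × Y) (X × Y) ℂ} {A : Matrix X X ℂ} {B : Matrix Y Y ℂ}
    (hB : Bᴴ * B = 1) (h : M * (A ⊗ₖ B) = (A ⊗ₖ B) * M) :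
    partialTrace M * A = A * partialTrace M := by
  have hB' : B * Bᴴ = 1 := mul_eq_one_comm.1 hB
  have hAB : A ⊗ₖ B = (A ⊗ₖ (1 : Matrix Y Y ℂ)) * ((1 : Matrix X X ℂ) ⊗ₖ B) := by
    rw [← Matrix.mul_kronecker_mul, Matrix.mul_one, Matrix.one_mul]
  have h1 : A ⊗ₖ (1 : Matrix Y Y ℂ) = (A ⊗ₖ B) * ((1 : Matrix X X ℂ) ⊗ₖ Bᴴ) := by
    rw [← Matrix.mul_kronecker_mul, Matrix.mul_one, hB']
  calc partialTrace M * A = partialTrace (M * (A ⊗ₖ B) * ((1 : Matrix X X ℂ) ⊗ₖ Bᴴ)) := by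
        rw [← partialTrace_mul_kronecker_one, h1, Matrix.mul_assoc]
    _ = A * partialTrace (((1 : Matrix X X ℂ) ⊗ₖ B) * (M * ((1 : Matrix X X ℂ) ⊗ₖ Bᴴ))) := by
        rw [h, hAB, Matrix.mul_assoc, Matrix.mul_assoc, partialTrace_kronecker_one_mul]
    _ = A * partialTrace M := by
        rw [partialTrace_one_kronecker_mul, Matrix.mul_assoc, ← Matrix.mul_kronecker_mul, hB,
          Matrix.mul_one, Matrix.one_kronecker_one, Matrix.mul_one]

end PartialTrace

/-! ### Detection of errors -/

namespace EAQuantumCode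

variable {q n k c : ℕ} (Q : EAQuantumCode q n k c)

/-- The block of the encoder for a given state of the sender's halves. -/
def encBlock (r : Fin c → Fin q) : Matrix (Fin n → Fin q) (Fin k → Fin q) ℂ :=
  Matrix.of fun x p => Q.enc x (p, r)

theorem encode_apply (φ : (Fin k → Fin q) → ℂ) (x : Fin n → Fin q) (r : Fin c → Fin q) :
    Q.encode φ (x, r) = ((Real.sqrt ((q : ℝ) ^ c))⁻¹ : ℂ) * (Q.encBlock r *ᵥ φ) x := by
  simp only [encode, maxEntangledState, Matrix.mulVec, dotProduct, Fintype.sum_prod_type,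
    Matrix.kroneckerMap_apply, Matrix.one_apply, mul_ite, mul_one, mul_zero, ite_mul, zero_mul,
    Finset.sum_ite_eq, Finset.mem_univ, if_true, encBlock, Matrix.of_apply]
  rw [Finset.mul_sum]
  refine Finset.sum_congr rfl fun p _ => ?_
  ring

theorem partialTrace_compression (E : Matrix (Fin n → Fin q) (Fin n → Fin q) ℂ) :
    partialTrace (Q.encᴴ * E * Q.enc) = ∑ r, (Q.encBlock r)ᴴ * E * Q.encBlock r := by
  ext p p'
  rw [Matrix.sum_apply]
  rfl

/-- The receiver's untouched register is a copy of the label `r` of the sender's halves, so only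
equal labels overlap; summing over `r` is a partial trace, normalised by `q ^ c`. -/
theorem encode_dotProduct (E : Matrix (Fin n → Fin q) (Fin n → Fin q) ℂ)
    (φ ψ : (Fin k → Fin q) → ℂ) :
    star (Q.encode φ) ⬝ᵥ
      ((E ⊗ₖ (1 : Matrix (Fin c → Fin q) (Fin c → Fin q) ℂ)) *ᵥ Q.encode ψ) =
      (((q : ℝ) ^ c : ℝ) : ℂ)⁻¹ * (star φ ⬝ᵥ (partialTrace (Q.encᴴ * E * Q.enc) *ᵥ ψ)) := by
  set s : ℂ := ((Real.sqrt ((q : ℝ) ^ c))⁻¹ : ℂ) with hs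
  have hss : star s * s = (((q : ℝ) ^ c : ℝ) : ℂ)⁻¹ := by
    have : star s = s := by
      rw [hs, ← Complex.ofReal_inv]
      exact Complex.conj_ofReal _
    rw [this, hs, ← mul_inv, ← Complex.ofReal_mul, Real.mul_self_sqrt (by positivity)]
  have h1 : ∀ x r, ((E ⊗ₖ (1 : Matrix (Fin c → Fin q) (Fin c → Fin q) ℂ)) *ᵥ Q.encode ψ) (x, r) =
      s * (E *ᵥ (Q.encBlock r *ᵥ ψ)) x := fun x r => by
    rw [Matrix.mulVec, dotProduct, Matrix.mulVec, dotProduct, Fintype.sum_prod_type,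
      Finset.mul_sum]
    refine Finset.sum_congr rfl fun y _ => ?_
    simp only [Matrix.kroneckerMap_apply, Matrix.one_apply, mul_ite, mul_one, mul_zero, ite_mul,
      zero_mul, Finset.sum_ite_eq, Finset.mem_univ, if_true, encode_apply]
    ring
  rw [partialTrace_compression, Matrix.sum_mulVec, dotProduct_sum, ← hss, Finset.mul_sum,
    dotProduct, Fintype.sum_prod_type_right]
  refine Finset.sum_congr rfl fun r _ => ?_
  rw [Matrix.mul_assoc, ← Matrix.mulVec_mulVec, Matrix.dotProduct_mulVec, ← Matrix.star_mulVec,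
    ← Matrix.mulVec_mulVec, dotProduct, Finset.mul_sum]
  refine Finset.sum_congr rfl fun x _ => ?_
  rw [h1, Pi.star_apply, encode_apply, star_mul', Pi.star_apply]
  ring

theorem detects_iff (hq : q ≠ 0) (E : Matrix (Fin n → Fin q) (Fin n → Fin q) ℂ) :
    Q.Detects E ↔ ∃ μ : ℂ, partialTrace (Q.encᴴ * E * Q.enc) = μ • 1 := by
  have hq' : (((q : ℝ) ^ c : ℝ) : ℂ) ≠ 0 := by
    simp [hq]
  constructor
  · rintro ⟨μ, hμ⟩
    refine ⟨(((q : ℝ) ^ c : ℝ) : ℂ) * μ, ?_⟩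
    ext x y
    have h := hμ (Pi.single x 1) (Pi.single y 1)
    rw [encode_dotProduct, inv_mul_eq_iff_eq_mul₀ hq'] at h
    simpa [Matrix.one_apply, ← Pi.single_star, Pi.single_apply, mul_assoc, eq_comm] using h
  · rintro ⟨μ, hμ⟩
    refine ⟨(((q : ℝ) ^ c : ℝ) : ℂ)⁻¹ * μ, fun φ ψ => ?_⟩
    rw [encode_dotProduct, hμ, Matrix.smul_mulVec, Matrix.one_mulVec, dotProduct_smul, smul_eq_mul,
      mul_assoc]

end EAQuantumCode

/-! ### Hermitian forms over finite fields -/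

section Hermitian

variable {F ι : Type*} [Field F] [Fintype ι] (σ : F →+* F)

/-- The standard Hermitian form for the involution `σ`, as a linear form in its second argument
`x`: `∑ i, x i * σ (y i)`. -/
def hermForm (y : ι → F) : (ι → F) →ₗ[F] F where
  toFun x := ∑ i, x i * σ (y i)
  map_add' x x' := by simp [add_mul, Finset.sum_add_distrib]
  map_smul' c x := by simp [mul_assoc, Finset.mul_sum]

theorem hermForm_apply (y x : ι → F) : hermForm σ y x = ∑ i, x i * σ (y i) := rfl

theorem hermForm_add_left (y y' x : ι → F) :
    hermForm σ (y + y') x = hermForm σ y x + hermForm σ y' x := by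
  simp [hermForm_apply, mul_add, Finset.sum_add_distrib]

theorem hermForm_smul_left (c : F) (y x : ι → F) :
    hermForm σ (c • y) x = σ c * hermForm σ y x := by
  simp [hermForm_apply, Finset.mul_sum, mul_left_comm]

theorem hermForm_sum_left {κ : Type*} (s : Finset κ) (y : κ → ι → F) (x : ι → F) :
    hermForm σ (∑ j ∈ s, y j) x = ∑ j ∈ s, hermForm σ (y j) x := by
  simp only [hermForm_apply, Finset.sum_apply, map_sum, Finset.mul_sum]
  exact Finset.sum_comm

variable {σ}

theorem map_hermForm (hσ : Function.Involutive σ) (x y : ι → F) :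
    σ (hermForm σ y x) = hermForm σ x y := by
  simp [hermForm_apply, hσ _, mul_comm]

theorem hermForm_eq_zero_comm (hσ : Function.Involutive σ) {x y : ι → F}
    (h : hermForm σ y x = 0) : hermForm σ x y = 0 := by
  rw [← map_hermForm hσ, h, map_zero]

theorem eq_zero_of_hermForm {x : ι → F}
    (h : ∀ y, hermForm σ y x = 0) : x = 0 := by
  classical
  funext i
  simpa [hermForm_apply, Pi.single_apply, apply_ite σ] using h (Pi.single i 1)

/-- If all vectors were isotropic, polarisation at `x` and at `α • x` would give two independent
relations between `hermForm σ y x` and `hermForm σ x y`, forcing both to vanish. -/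
theorem exists_hermForm_self_ne_zero {α : F} (hα : σ α ≠ α)
    {D : Submodule F (ι → F)} (hD : ∀ x ∈ D, (∀ y ∈ D, hermForm σ y x = 0) → x = 0)
    (hD0 : D ≠ ⊥) : ∃ x ∈ D, hermForm σ x x ≠ 0 := by
  by_contra! hc
  refine hD0 ((Submodule.eq_bot_iff D).2 fun x hx => hD x hx fun y hy => ?_)
  have hadd : ∀ z ∈ D, hermForm σ y z + hermForm σ z y = 0 := fun z hz => by
    have h := hc (y + z) (D.add_mem hy hz)
    rw [hermForm_add_left, map_add, map_add, hc y hy, hc z hz] at h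
    linear_combination h
  have h1 := hadd x hx
  have h2 := hadd (α • x) (D.smul_mem α hx)
  rw [map_smul, hermForm_smul_left, smul_eq_mul] at h2
  have h3 : (σ α - α) * hermForm σ y x = 0 := by linear_combination σ α * h1 - h2
  exact (mul_eq_zero.1 h3).resolve_left (sub_ne_zero.2 hα)

/-- A nondegenerate subspace for the Hermitian form has a finite orthonormal basis. -/
theorem exists_orthonormal_basis (hσ : Function.Involutive σ) {α : F} (hα : σ α ≠ α)
    (hN : ∀ t, t ≠ 0 → σ t = t → ∃ s, s * σ s = t)
    (D : Submodule F (ι → F)) (hD : ∀ x ∈ D, (∀ y ∈ D, hermForm σ y x = 0) → x = 0) :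
    ∃ (m : ℕ) (u : Fin m → ι → F), (∀ i, u i ∈ D) ∧
      (∀ i j, hermForm σ (u i) (u j) = if i = j then 1 else 0) ∧
      ∀ x ∈ D, x = ∑ i, hermForm σ (u i) x • u i := by
  induction hm : Module.finrank F D using Nat.strong_induction_on generalizing D with
  | _ m ih =>
  by_cases hD0 : D = ⊥
  · refine ⟨0, Fin.elim0, fun i => i.elim0, fun i => i.elim0, fun x hx => ?_⟩
    rw [hD0, Submodule.mem_bot] at hx
    simp [hx]
  obtain ⟨x₁, hx₁, hne⟩ := exists_hermForm_self_ne_zero hα hD hD0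
  -- Scaling by `s` multiplies the value on `x₁` by `s * σ s`, which normalises it to `1`. Induction
  -- then continues on the orthogonal complement in `D`.
  obtain ⟨s, hs⟩ := hN (hermForm σ x₁ x₁)⁻¹ (inv_ne_zero hne) (by rw [map_inv₀, map_hermForm hσ])
  obtain ⟨x₀, hx₀, h1⟩ : ∃ x₀ ∈ D, hermForm σ x₀ x₀ = 1 := by
    refine ⟨s • x₁, D.smul_mem s hx₁, ?_⟩
    rw [hermForm_smul_left, map_smul, smul_eq_mul, ← mul_assoc, mul_comm (σ s), hs,
      inv_mul_cancel₀ hne]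
  have hlt : D ⊓ LinearMap.ker (hermForm σ x₀) < D := by
    refine lt_of_le_of_ne inf_le_left fun h => ?_
    rw [← h] at hx₀
    exact one_ne_zero (h1.symm.trans hx₀.2)
  have hproj : ∀ x ∈ D, x - hermForm σ x₀ x • x₀ ∈ D ⊓ LinearMap.ker (hermForm σ x₀) :=
    fun x hx => ⟨D.sub_mem hx (D.smul_mem _ hx₀), by simp [h1]⟩
  obtain ⟨m', u, hu, huu, hexp⟩ := ih _ (hm ▸ Submodule.finrank_lt_finrank_of_lt hlt) _
    (fun x hx h => hD x (Submodule.mem_inf.1 hx).1 fun y hy => by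
      have h2 := h _ (hproj y hy)
      have hx0 : hermForm σ x₀ x = 0 := (Submodule.mem_inf.1 hx).2
      have : y = (y - hermForm σ x₀ y • x₀) + hermForm σ x₀ y • x₀ := by simp
      rw [this, hermForm_add_left, h2, hermForm_smul_left, hx0, mul_zero, add_zero]) rfl
  have hu0 : ∀ i, hermForm σ x₀ (u i) = 0 := fun i => (hu i).2
  refine ⟨m' + 1, Fin.cons x₀ u, fun i => ?_, fun i j => ?_, fun x hx => ?_⟩
  · refine Fin.cases hx₀ (fun i => ?_) i
    exact (hu i).1
  · refine Fin.cases ?_ (fun i => ?_) i <;> refine Fin.cases ?_ (fun j => ?_) j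
    · simpa using h1
    · simpa [(Fin.succ_ne_zero j).symm] using hu0 j
    · simpa [Fin.succ_ne_zero i] using hermForm_eq_zero_comm hσ (hu0 i)
    · simpa using huu i j
  · have h := hexp _ (hproj x hx)
    rw [Fin.sum_univ_succ]
    simp only [Fin.cons_zero, Fin.cons_succ]
    rw [← sub_eq_iff_eq_add']
    refine h.trans (Finset.sum_congr rfl fun i _ => ?_)
    rw [map_sub, map_smul, hermForm_eq_zero_comm hσ (hu0 i), smul_zero, sub_zero]

/-- A nondegenerate subspace of `F ^ n` for the standard Hermitian form is the image of the first
`k` coordinates under a unitary map. -/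
theorem exists_unitary_splitting (hσ : Function.Involutive σ) {α : F} (hα : σ α ≠ α)
    (hN : ∀ t, t ≠ 0 → σ t = t → ∃ s, s * σ s = t) {n : ℕ}
    (D : Submodule F (Fin n → F)) (hD : ∀ x ∈ D, (∀ y ∈ D, hermForm σ y x = 0) → x = 0) :
    ∃ c, Module.finrank F D + c = n ∧
      ∃ U : ((Fin (Module.finrank F D) → F) × (Fin c → F)) ≃ₗ[F] (Fin n → F),
      (∀ p p', hermForm σ (U p) (U p') = hermForm σ p.1 p'.1 + hermForm σ p.2 p'.2) ∧
      (∀ a, U (a, 0) ∈ D) ∧ ∀ x ∈ D, ∃ a, U (a, 0) = x := by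
  obtain ⟨m, u, huD, huu, hue⟩ := exists_orthonormal_basis hσ hα hN D hD
  let D' : Submodule F (Fin n → F) := ⨅ i, LinearMap.ker (hermForm σ (u i))
  have hD' : ∀ x, x ∈ D' ↔ ∀ i, hermForm σ (u i) x = 0 := fun x => by
    simp [D', Submodule.mem_iInf]
  have horth : ∀ x ∈ D', ∀ y ∈ D, hermForm σ y x = 0 := fun x hx y hy => by
    rw [hue y hy, hermForm_sum_left]
    refine Finset.sum_eq_zero fun i _ => ?_
    rw [hermForm_smul_left, (hD' x).1 hx i, mul_zero]
  have hproj : ∀ x, x - ∑ i, hermForm σ (u i) x • u i ∈ D' := fun x => by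
    rw [hD']
    intro i
    simp [map_sum, huu]
  have hsumD : ∀ a : Fin m → F, ∑ i, a i • u i ∈ D := fun a =>
    D.sum_mem fun i _ => D.smul_mem _ (huD i)
  -- `D'` is nondegenerate: a vector of `D'` orthogonal to `D'` is also orthogonal to `D`, hence to
  -- the whole space.
  obtain ⟨c, v, hvD, hvv, hve⟩ := exists_orthonormal_basis hσ hα hN D' fun x hx h => by
    refine eq_zero_of_hermForm (σ := σ) fun y => ?_
    have : y = (y - ∑ i, hermForm σ (u i) y • u i) + ∑ i, hermForm σ (u i) y • u i := by simp
    rw [this, hermForm_add_left, h _ (hproj y), horth x hx _ (hsumD _), add_zero]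
  have huv : ∀ i j, hermForm σ (u i) (v j) = 0 := fun i j => horth _ (hvD j) _ (huD i)
  have hvu : ∀ i j, hermForm σ (v j) (u i) = 0 := fun i j => hermForm_eq_zero_comm hσ (huv i j)
  let U : ((Fin m → F) × (Fin c → F)) ≃ₗ[F] (Fin n → F) :=
    { toFun := fun p => ∑ i, p.1 i • u i + ∑ j, p.2 j • v j
      map_add' := fun p p' => by
        simp only [Prod.fst_add, Prod.snd_add, Pi.add_apply, add_smul, Finset.sum_add_distrib]
        abel
      map_smul' := fun t p => by
        simp [Finset.smul_sum, smul_smul]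
      invFun := fun x => (fun i => hermForm σ (u i) x, fun j => hermForm σ (v j) x)
      left_inv := fun p => by
        ext i <;> simp [map_sum, huu, hvv, huv, hvu]
      right_inv := fun x => by
        have h := hve _ (hproj x)
        have h2 : ∀ j, hermForm σ (v j) (x - ∑ i, hermForm σ (u i) x • u i) =
            hermForm σ (v j) x := fun j => by simp [map_sum, hvu]
        simp only [h2] at h
        change ∑ i, hermForm σ (u i) x • u i + ∑ j, hermForm σ (v j) x • v j = x
        rw [← h]
        simp }
  have hU : ∀ p, U p = ∑ i, p.1 i • u i + ∑ j, p.2 j • v j := fun p => rfl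
  have hUD : ∀ a, U (a, 0) ∈ D := fun a => by
    simpa [hU] using hsumD a
  have hUD' : ∀ x ∈ D, ∃ a, U (a, 0) = x := fun x hx =>
    ⟨fun i => hermForm σ (u i) x, by simpa [hU] using (hue x hx).symm⟩
  have hUU : ∀ p p', hermForm σ (U p) (U p') = hermForm σ p.1 p'.1 + hermForm σ p.2 p'.2 := by
    intro p p'
    rw [hU p, hermForm_add_left, hermForm_sum_left, hermForm_sum_left]
    congr 1
    · rw [hermForm_apply]
      refine Finset.sum_congr rfl fun i _ => ?_
      rw [hermForm_smul_left, mul_comm]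
      simp [hU, map_sum, huu, huv]
    · rw [hermForm_apply]
      refine Finset.sum_congr rfl fun i _ => ?_
      rw [hermForm_smul_left, mul_comm]
      simp [hU, map_sum, hvv, hvu]
  have hmD : Module.finrank F D = m := by
    let L : (Fin m → F) →ₗ[F] D :=
      (U.toLinearMap ∘ₗ LinearMap.inl F (Fin m → F) (Fin c → F)).codRestrict D hUD
    have hL : Function.Bijective L := by
      constructor
      · intro a b h
        have := U.injective (congrArg Subtype.val h : U (a, 0) = U (b, 0))
        exact congrArg Prod.fst this
      · rintro ⟨x, hx⟩
        obtain ⟨a, ha⟩ := hUD' x hx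
        exact ⟨a, Subtype.ext ha⟩
    simpa using (LinearEquiv.ofBijective L hL).finrank_eq.symm
  subst hmD
  exact ⟨c, by simpa using U.finrank_eq, U, hUU, hUD, hUD'⟩

end Hermitian

/-! ### Fields with `q ^ 2` elements -/

section FieldFacts

variable {F : Type*} [Field F] [Fintype F] {q : ℕ}

/-- The cardinality vanishes in `F`, so the prime under `q` is the characteristic and the map is an
iterated Frobenius. -/
theorem exists_ringHom_pow (hq : IsPrimePow q) (hF : Fintype.card F = q ^ 2) :
    ∃ σ : F →+* F, ∀ x, σ x = x ^ q := by
  obtain ⟨p, m, hp, hm, rfl⟩ := hq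
  have hp : p.Prime := hp.nat_prime
  have hp0 : (p : F) = 0 := by
    have h := Nat.cast_card_eq_zero F
    rw [hF] at h
    push_cast at h
    exact pow_eq_zero_iff hm.ne' |>.1 (pow_eq_zero_iff two_ne_zero |>.1 h)
  obtain ⟨r, hr⟩ := CharP.exists F
  obtain rfl : r = p :=
    ((Nat.dvd_prime hp).1 ((CharP.cast_eq_zero_iff F r p).1 hp0)).resolve_left
      (CharP.char_ne_one F r)
  have : ExpChar F r := ExpChar.prime hp
  exact ⟨iterateFrobenius F r m, fun x => iterateFrobenius_def r m x⟩

theorem pow_pow_eq_self (hF : Fintype.card F = q ^ 2) (x : F) : (x ^ q) ^ q = x := by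
  rw [← pow_mul, ← sq, ← hF, FiniteField.pow_card]

theorem exists_orderOf_eq (hF : Fintype.card F = q ^ 2) (hq : 2 ≤ q) :
    ∃ g : Fˣ, orderOf g = (q - 1) * (q + 1) ∧ ∀ x, x ∈ Submonoid.powers g := by
  classical
  obtain ⟨g, hg⟩ := IsCyclic.exists_monoid_generator (α := Fˣ)
  refine ⟨g, ?_, hg⟩
  rw [orderOf_eq_card_of_forall_mem_powers hg, Nat.card_eq_fintype_card, Fintype.card_units, hF]
  obtain ⟨r, rfl⟩ : ∃ r, q = r + 1 := ⟨q - 1, by omega⟩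
  simp only [Nat.add_sub_cancel]
  exact Nat.sub_eq_of_eq_add (by ring)

theorem exists_pow_ne (hF : Fintype.card F = q ^ 2) (hq : 2 ≤ q) : ∃ α : F, α ^ q ≠ α := by
  obtain ⟨g, hg, -⟩ := exists_orderOf_eq hF hq
  refine ⟨g, fun h => ?_⟩
  have h1 : g ^ q = g := Units.ext (by simpa using h)
  have h2 : g ^ (q - 1) = 1 := by
    have : g ^ (q - 1) * g = 1 * g := by rw [← pow_succ, Nat.sub_add_cancel (by omega), h1, one_mul]
    exact mul_right_cancel this
  have h3 := Nat.le_of_dvd (by omega) (hg ▸ orderOf_dvd_of_pow_eq_one h2)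
  nlinarith [show 1 ≤ q - 1 by omega]

/-- Surjectivity of the norm: write `t = g ^ j` for a generator `g` of order `(q - 1) * (q + 1)`.
Since `t ^ (q - 1) = 1`, the exponent `j` is a multiple of `q + 1`. -/
theorem exists_mul_pow_eq (hF : Fintype.card F = q ^ 2) (hq : 2 ≤ q) {t : F} (ht : t ≠ 0)
    (htq : t ^ q = t) : ∃ s : F, s * s ^ q = t := by
  obtain ⟨g, hg, hgen⟩ := exists_orderOf_eq hF hq
  obtain ⟨j, hj⟩ := hgen (Units.mk0 t ht)
  have hj : g ^ j = Units.mk0 t ht := hj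
  have h1 : t ^ (q - 1) = 1 := by
    have : t ^ (q - 1) * t = 1 * t := by rw [← pow_succ, Nat.sub_add_cancel (by omega), htq, one_mul]
    exact mul_right_cancel₀ ht this
  have h2 : g ^ ((q - 1) * j) = 1 := by
    rw [mul_comm, pow_mul, hj]
    exact Units.ext (by simpa using h1)
  obtain ⟨l, rfl⟩ : q + 1 ∣ j :=
    Nat.dvd_of_mul_dvd_mul_left (by omega) (hg ▸ orderOf_dvd_of_pow_eq_one h2)
  refine ⟨(g ^ l : Fˣ), ?_⟩
  have := congrArg Units.val hj
  simp only [Units.val_mk0, Units.val_pow_eq_pow_val] at this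
  rw [← this, Units.val_pow_eq_pow_val]
  ring

end FieldFacts

/-! ### Coordinates over the fixed field of the involution -/

section Coordinates

variable {F : Type*} [Field F]

/-- The subfield fixed by a ring endomorphism. -/
abbrev fixedSubfield (σ : F →+* F) : Subfield F := σ.eqLocusField (RingHom.id F)

/-- Coordinates of `F` over the fixed field of an involution, in which the alternating form
attached to `σ` becomes the standard one, up to a scalar. -/
theorem exists_coordinates {σ : F →+* F} (hσ : Function.Involutive σ) {α : F} (hα : σ α ≠ α) :
    ∃ co : F ≃ fixedSubfield σ × fixedSubfield σ, co 0 = 0 ∧ ∀ v w : F,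
      (((co v).2 * (co w).1 - (co w).2 * (co v).1 : fixedSubfield σ) : F) =
        (σ α - α)⁻¹ * (w * σ v - v * σ w) := by
  have hδ : σ α - α ≠ 0 := sub_ne_zero.2 hα
  -- Applying `σ` to `v = a + α * b` with `a`, `b` fixed and subtracting solves for `b`.
  let b : F → F := fun v => (σ α - α)⁻¹ * (σ v - v)
  have hb : ∀ v, σ (b v) = b v := fun v => by
    simp only [b, map_mul, map_inv₀, map_sub, hσ _]
    rw [← neg_sub (σ α), ← neg_sub (σ v), inv_neg, neg_mul_neg]
  have hbv : ∀ v, (σ α - α) * b v = σ v - v := fun v => by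
    simp only [b]
    rw [mul_inv_cancel_left₀ hδ]
  let a : F → F := fun v => v - α * b v
  have ha : ∀ v, σ (a v) = a v := fun v => by
    simp only [a, map_sub, map_mul, hb]
    linear_combination -(hbv v)
  refine ⟨⟨fun v => (⟨a v, ha v⟩, ⟨b v, hb v⟩), fun p => (p.1 : F) + α * p.2, fun v => ?_,
    fun p => ?_⟩, ?_, fun v w => ?_⟩
  · simp [a]
  · have h1 : σ (p.1 : F) = p.1 := p.1.2
    have h2 : σ (p.2 : F) = p.2 := p.2.2
    have h3 : b ((p.1 : F) + α * p.2) = p.2 := by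
      refine mul_left_cancel₀ hδ ?_
      rw [hbv, map_add, map_mul, h1, h2]
      ring
    ext
    · simp [a, h3]
    · simp [h3]
  · ext <;> simp [a, b]
  · refine mul_left_cancel₀ hδ ?_
    rw [mul_inv_cancel_left₀ hδ]
    change (σ α - α) * (b v * (w - α * b w) - b w * (v - α * b v)) = _
    linear_combination w * hbv v - v * hbv w

end Coordinates

/-! ### Weyl operators and supports -/

section Support

variable {K : Type*} [Field K] {q n : ℕ} (e : Fin q ≃ K) (ψ : AddChar K ℂ)

theorem weyl_actsOnlyOn {a b : Fin n → K} {S : Finset (Fin n)} (ha : ∀ i ∉ S, a i = 0)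
    (hb : ∀ i ∉ S, b i = 0) : ActsOnlyOn (weyl e ψ a b) S := by
  classical
  refine ⟨Matrix.of fun x y => if ∀ i : S, x i = e.symm (e (y i) + a i) then
    ψ (∑ i : S, b i * e (y i)) else 0, fun x y => ?_⟩
  have hchar : labelChar e ψ b y = ψ (∑ i : S, b i * e (y i)) := by
    rw [labelChar, Finset.sum_coe_sort S fun i => b i * e (y i)]
    congr 1
    refine (Finset.sum_subset (Finset.subset_univ S) fun i _ hi => ?_).symm
    rw [hb i hi, zero_mul]
  have hiff : x = labelShift e a y ↔
      (∀ i, i ∉ S → x i = y i) ∧ ∀ i : S, x i = e.symm (e (y i) + a i) := by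
    constructor
    · rintro rfl
      refine ⟨fun i hi => ?_, fun i => rfl⟩
      simp [labelShift, ha i hi]
    · rintro ⟨h1, h2⟩
      funext i
      by_cases hi : i ∈ S
      · exact h2 ⟨i, hi⟩
      · simp [labelShift, ha i hi, h1 i hi]
  rw [weyl_apply, hchar]
  simp only [hiff, Matrix.of_apply]
  by_cases h1 : ∀ i, i ∉ S → x i = y i <;>
    by_cases h2 : ∀ i : S, x i = e.symm (e (y i) + a i) <;> simp only [h1, h2] <;> simp

/-- The two operators act on disjoint sets of qudits. On the nonzero entries the labels match off
`S`, and these are all that the phase sees. -/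
theorem ActsOnlyOn.commute_weyl {M : Matrix (Fin n → Fin q) (Fin n → Fin q) ℂ}
    {S : Finset (Fin n)} (hM : ActsOnlyOn M S) {a b : Fin n → K} (ha : ∀ i ∈ S, a i = 0)
    (hb : ∀ i ∈ S, b i = 0) : M * weyl e ψ a b = weyl e ψ a b * M := by
  obtain ⟨A, hA⟩ := hM
  ext x y
  rw [mul_weyl_apply, weyl_mul_apply, hA, hA]
  have hiff : (∀ i, i ∉ S → x i = labelShift e a y i) ↔
      ∀ i, i ∉ S → labelShift e (-a) x i = y i := by
    refine forall₂_congr fun i _ => ?_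
    simp [labelShift, Equiv.eq_symm_apply, Equiv.symm_apply_eq, ← sub_eq_add_neg,
      sub_eq_iff_eq_add]
  have hx : (fun i : S => labelShift e (-a) x i) = fun i : S => x i := by
    funext i
    simp [labelShift, ha i i.2]
  have hy : (fun i : S => labelShift e a y i) = fun i : S => y i := by
    funext i
    simp [labelShift, ha i i.2]
  by_cases h : ∀ i, i ∉ S → labelShift e (-a) x i = y i
  · have hchar : labelChar e ψ b y = labelChar e ψ b (labelShift e (-a) x) := by
      rw [labelChar, labelChar]
      congr 1
      refine Finset.sum_congr rfl fun i _ => ?_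
      by_cases hi : i ∈ S
      · simp [hb i hi]
      · rw [h i hi]
    rw [if_pos h, if_pos (hiff.2 h), hx, hy, hchar, mul_comm]
  · rw [if_neg h, if_neg fun h' => h (hiff.1 h'), zero_mul, mul_zero]

end Support

theorem eq_zero_of_weyl_eq_smul_one {K Q ι : Type*} [Field K] [Fintype ι] [DecidableEq ι]
    [DecidableEq Q] (e : Q ≃ K) {ψ : AddChar K ℂ} (hψ : ψ.IsPrimitive) {a b : ι → K} {μ : ℂ}
    (h : weyl e ψ a b = μ • 1) : a = 0 ∧ b = 0 := by
  have hne : ∀ x : ι → Q, labelChar e ψ b x ≠ 0 := fun x => (AddChar.val_isUnit ψ _).ne_zero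
  let x₀ : ι → Q := fun _ => e.symm 0
  have ha : a = 0 := by
    have h1 := congrFun (congrFun h (labelShift e a x₀)) x₀
    rw [weyl_apply, if_pos rfl, Matrix.smul_apply, Matrix.one_apply] at h1
    split_ifs at h1 with h2
    · funext i
      simpa [labelShift, x₀] using congrFun h2 i
    · simp [hne] at h1
  subst ha
  refine ⟨rfl, ?_⟩
  have hx : ∀ x, labelChar e ψ b x = μ := fun x => by
    simpa [weyl_apply] using congrFun (congrFun h x) x
  funext i
  by_contra hi
  obtain ⟨t, ht⟩ := DFunLike.ne_iff.1 (hψ hi)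
  refine ht ?_
  have h1 := (hx fun j => e.symm ((Pi.single i t : ι → K) j)).trans (hx x₀).symm
  simpa [labelChar, x₀, Pi.single_apply, AddChar.mulShift_apply] using h1

/-! ### Weyl operators labelled by vectors over the large field -/

section VectorWeyl

variable {F K Q ι : Type*} [Field K] [Fintype ι] [DecidableEq Q]
  (co : F ≃ K × K) (e : Q ≃ K) (ψ : AddChar K ℂ)

/-- The Weyl operator whose labels are the coordinates of a vector. -/
def vectorWeyl (v : ι → F) : Matrix (ι → Q) (ι → Q) ℂ :=
  weyl e ψ (fun i => (co (v i)).1) fun i => (co (v i)).2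

/-- The alternating form which governs the commutation of Weyl operators. -/
def commForm (v w : ι → F) : K :=
  ∑ i, ((co (v i)).2 * (co (w i)).1 - (co (w i)).2 * (co (v i)).1)

theorem exists_vectorWeyl_eq (a b : ι → K) : ∃ v, vectorWeyl co e ψ v = weyl e ψ a b :=
  ⟨fun i => co.symm (a i, b i), by simp [vectorWeyl]⟩

theorem vectorWeyl_zero [Zero F] (h0 : co 0 = 0) : vectorWeyl co e ψ (0 : ι → F) = 1 := by
  rw [← weyl_zero e ψ]
  simp only [vectorWeyl, Pi.zero_apply, h0]
  rfl

theorem conjTranspose_vectorWeyl_mul_self [DecidableEq ι] [Finite K] [Fintype Q] (v : ι → F) :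
    (vectorWeyl co e ψ v)ᴴ * vectorWeyl co e ψ v = 1 :=
  conjTranspose_weyl_mul_weyl e ψ _ _

theorem vectorWeyl_comm [DecidableEq ι] [Fintype Q] (v w : ι → F) :
    vectorWeyl co e ψ v * vectorWeyl co e ψ w =
      ψ (commForm co v w) • (vectorWeyl co e ψ w * vectorWeyl co e ψ v) := by
  rw [vectorWeyl, vectorWeyl, weyl_comm]
  simp [commForm, dotProduct]

theorem eq_zero_of_vectorWeyl_eq_smul_one [Zero F] [DecidableEq ι] {ψ : AddChar K ℂ}
    (h0 : co 0 = 0) (hψ : ψ.IsPrimitive) {v : ι → F} {μ : ℂ}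
    (h : vectorWeyl co e ψ v = μ • 1) : v = 0 := by
  obtain ⟨h1, h2⟩ := eq_zero_of_weyl_eq_smul_one e hψ h
  funext i
  refine co.injective (Prod.ext ?_ ?_)
  · simpa [h0] using congrFun h1 i
  · simpa [h0] using congrFun h2 i

end VectorWeyl

/-- This is how a unitary map for the Hermitian form comes to preserve the commutation phases of
Weyl operators. -/
theorem coe_commForm {F : Type*} [Field F] {σ : F →+* F} {α : F}
    (co : F ≃ fixedSubfield σ × fixedSubfield σ)
    (hco : ∀ v w : F, (((co v).2 * (co w).1 - (co w).2 * (co v).1 : fixedSubfield σ) : F) =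
        (σ α - α)⁻¹ * (w * σ v - v * σ w)) {ι : Type*} [Fintype ι] (v w : ι → F) :
    ((commForm co v w : fixedSubfield σ) : F) = (σ α - α)⁻¹ * (hermForm σ v w - hermForm σ w v) := by
  rw [commForm, AddSubmonoidClass.coe_finsetSum, hermForm_apply, hermForm_apply,
    ← Finset.sum_sub_distrib, Finset.mul_sum]
  exact Finset.sum_congr rfl fun i _ => hco _ _

/-- A unitary splitting of `F ^ n` is implemented, up to phases, by an isometry. -/
theorem exists_encoder {F K : Type*} [Field F] [Finite F] [Field K] [Finite K] {q n k c : ℕ}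
    (co : F ≃ K × K) (e : Fin q ≃ K) {ψ : AddChar K ℂ} (hψ : ψ.IsPrimitive)
    (U : ((Fin k → F) × (Fin c → F)) → (Fin n → F))
    (hU : ∀ p p', commForm co (U p) (U p') = commForm co p.1 p'.1 + commForm co p.2 p'.2) :
    ∃ W : Matrix (Fin n → Fin q) ((Fin k → Fin q) × (Fin c → Fin q)) ℂ, Wᴴ * W = 1 ∧
      ∀ p, ∃ θ : ℂ, star θ * θ = 1 ∧ vectorWeyl co e ψ (U p) * W =
        θ • (W * (vectorWeyl co e ψ p.1 ⊗ₖ vectorWeyl co e ψ p.2)) := by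
  have : Nonempty (Fin q) := ⟨e.symm 0⟩
  refine exists_isometric_intertwiner (fun p => vectorWeyl co e ψ (U p))
    (fun p => vectorWeyl co e ψ p.1 ⊗ₖ vectorWeyl co e ψ p.2)
    (fun p p' => ψ (commForm co (U p) (U p')))
    (fun p => conjTranspose_vectorWeyl_mul_self co e ψ _) (fun p => ?_) (fun p p' => ?_)
    (fun p p' => vectorWeyl_comm co e ψ _ _) (fun p p' => ?_) fun P hP => ?_
  · rw [Matrix.conjTranspose_kronecker, ← Matrix.mul_kronecker_mul,
      conjTranspose_vectorWeyl_mul_self, conjTranspose_vectorWeyl_mul_self,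
      Matrix.one_kronecker_one]
  · rw [← starRingEnd_apply, Complex.conj_mul', AddChar.norm_apply]
    simp
  · rw [← Matrix.mul_kronecker_mul, ← Matrix.mul_kronecker_mul,
      vectorWeyl_comm co e ψ p.1, vectorWeyl_comm co e ψ p.2, hU, AddChar.map_add_eq_mul,
      Matrix.smul_kronecker, Matrix.kronecker_smul, smul_smul]
  · refine eq_smul_one_of_commute_weyl_kronecker e hψ P fun a b a' b' => ?_
    obtain ⟨v, hv⟩ := exists_vectorWeyl_eq co e ψ a b
    obtain ⟨w, hw⟩ := exists_vectorWeyl_eq co e ψ a' b'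
    rw [← hv, ← hw]
    exact hP (v, w)

/-- If no nonzero vector of the form `U (a, 0)` is supported in `S`, every `a` is the first
component of a vector vanishing on `S`. -/
theorem exists_extension_vanishing {F : Type*} [Field F] {σ : F →+* F}
    (hσ : Function.Involutive σ) {n k c : ℕ}
    (U : ((Fin k → F) × (Fin c → F)) ≃ₗ[F] (Fin n → F))
    (hU : ∀ p p', hermForm σ (U p) (U p') = hermForm σ p.1 p'.1 + hermForm σ p.2 p'.2)
    {S : Finset (Fin n)} (hS : ∀ a, (∀ i ∉ S, U (a, 0) i = 0) → a = 0) (a : Fin k → F) :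
    ∃ b, ∀ i ∈ S, U (a, b) i = 0 := by
  let B : Submodule F ((Fin k → F) × (Fin c → F)) :=
    ⨅ i ∈ S, LinearMap.ker (LinearMap.proj i ∘ₗ U.toLinearMap)
  have hB : ∀ p, p ∈ B ↔ ∀ i ∈ S, U p i = 0 := fun p => by
    simp [B, Submodule.mem_iInf]
  suffices h : B.map (LinearMap.fst F _ _) = ⊤ by
    obtain ⟨⟨a', b⟩, hp, rfl⟩ : a ∈ B.map (LinearMap.fst F _ _) := h ▸ Submodule.mem_top
    exact ⟨b, (hB _).1 hp⟩
  by_contra hne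
  -- A functional killing the projection of `B` is the form against some `x`. For `i ∉ S` the
  -- preimage under `U` of the `i`-th unit vector lies in `B`, so unitarity gives `U (x, 0) i = 0`;
  -- the hypothesis then forces `x = 0`.
  obtain ⟨f, hf0, hf⟩ := Submodule.exists_le_ker_of_lt_top _ (lt_top_iff_ne_top.2 hne)
  let x : Fin k → F := fun i => σ (f (Pi.single i 1))
  have hx : hermForm σ x = f := by
    refine LinearMap.pi_ext' fun i => LinearMap.ext_ring ?_
    simp [hermForm_apply, x, hσ _, Pi.single_apply]
  have hx0 : x = 0 := by
    refine hS x fun i hi => ?_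
    have hmem : U.symm (Pi.single i 1) ∈ B := (hB _).2 fun j hj => by
      rw [LinearEquiv.apply_symm_apply]
      exact Pi.single_eq_of_ne (ne_of_mem_of_not_mem hj hi) _
    have h1 := hU (x, 0) (U.symm (Pi.single i 1))
    have h2 : f (U.symm (Pi.single i 1)).1 = 0 := hf ⟨_, hmem, rfl⟩
    have h3 : σ (U (x, 0) i) = 0 := by
      simpa [hx, h2, hermForm_apply, Pi.single_apply] using h1
    exact (map_eq_zero σ).1 h3
  refine hf0 ?_
  rw [← hx, hx0]
  ext
  simp [hermForm_apply]

/-! ### Detected and undetected errors of the intertwining encoder -/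

namespace EAQuantumCode

variable {F K : Type*} [Field F] [Field K] {q n k c : ℕ} (Q : EAQuantumCode q n k c)
  {co : F ≃ K × K} (h0 : co 0 = 0) (e : Fin q ≃ K) {ψ : AddChar K ℂ} (hψ : ψ.IsPrimitive)
  {U : ((Fin k → F) × (Fin c → F)) → (Fin n → F)}
  (hQ : ∀ p, ∃ θ : ℂ, star θ * θ = 1 ∧ vectorWeyl co e ψ (U p) * Q.enc =
    θ • (Q.enc * (vectorWeyl co e ψ p.1 ⊗ₖ vectorWeyl co e ψ p.2)))
include h0 hψ hQ

/-- For each `a`, a suitable `b` moves the Weyl operator of `U (a, b)` off `S`, where it commutes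
with `E`. Compressing and tracing out the second factor leaves commutation with the Weyl operator of
`a`, and Schur's lemma applies. -/
theorem detects_of_actsOnlyOn [Finite K] {S : Finset (Fin n)}
    (hS : ∀ a, ∃ b, ∀ i ∈ S, U (a, b) i = 0)
    {E : Matrix (Fin n → Fin q) (Fin n → Fin q) ℂ} (hE : ActsOnlyOn E S) : Q.Detects E := by
  have hq : q ≠ 0 := by
    rintro rfl
    exact (e.symm 0).elim0
  rw [detects_iff Q hq]
  refine eq_smul_one_of_commute_weyl e hψ _ fun a' b' => ?_
  obtain ⟨a, ha⟩ := exists_vectorWeyl_eq co e ψ a' b'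
  rw [← ha]
  obtain ⟨b, hb⟩ := hS a
  obtain ⟨θ, hθ, hW⟩ := hQ (a, b)
  refine partialTrace_commute (conjTranspose_vectorWeyl_mul_self co e ψ b)
    (commute_compression (conjTranspose_vectorWeyl_mul_self co e ψ (U (a, b))) ?_ hθ hW
      (hE.commute_weyl e ψ (fun i hi => ?_) fun i hi => ?_))
  · rw [Matrix.conjTranspose_kronecker, ← Matrix.mul_kronecker_mul,
      conjTranspose_vectorWeyl_mul_self, conjTranspose_vectorWeyl_mul_self,
      Matrix.one_kronecker_one]
  · simp [hb i hi, h0]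
  · simp [hb i hi, h0]

/-- With second component zero the compression is a phase times `vectorWeyl co e ψ a ⊗ₖ 1`, so the
partial trace only contributes a nonzero factor. -/
theorem not_detects_vectorWeyl {a : Fin k → F} (ha : a ≠ 0) :
    ¬ Q.Detects (vectorWeyl co e ψ (U (a, 0))) := by
  have : Nonempty (Fin q) := ⟨e.symm 0⟩
  have hq : q ≠ 0 := by
    rintro rfl
    exact (e.symm 0).elim0
  rw [detects_iff Q hq]
  rintro ⟨μ, hμ⟩
  obtain ⟨θ, hθ, hW⟩ := hQ (a, 0)
  have hc : θ * (Fintype.card (Fin c → Fin q) : ℂ) ≠ 0 :=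
    mul_ne_zero (right_ne_zero_of_mul_eq_one hθ) (Nat.cast_ne_zero.2 Fintype.card_ne_zero)
  rw [Matrix.mul_assoc, hW, Matrix.mul_smul, ← Matrix.mul_assoc, Q.enc_isometry, Matrix.one_mul,
    partialTrace_smul, partialTrace_kronecker, vectorWeyl_zero co e ψ h0, Matrix.trace_one,
    smul_smul] at hμ
  refine ha (eq_zero_of_vectorWeyl_eq_smul_one co e h0 hψ
    (μ := (θ * (Fintype.card (Fin c → Fin q) : ℂ))⁻¹ * μ) ?_)
  rw [← smul_smul, ← hμ, smul_smul, inv_mul_cancel₀ hc, one_smul]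

end EAQuantumCode

end

theorem mainTheorem10 {F : Type*} [Field F] [Fintype F] [DecidableEq F] (q : ℕ)
    (hq : IsPrimePow q) (hF : Fintype.card F = q ^ 2) {n k d : ℕ}
    (C : Submodule F (Fin n → F)) (hparam : HasParameters C k d)
    (hcyclic : IsCyclicCode C) (hLCD : IsHermitianLCD q C) :
    ∃ Q : EAQuantumCode q n k (n - k), Q.HasMinDistance d ∧ Q.IsMaximalEntanglement := by
  obtain ⟨rfl, ⟨x, hx, y, hy, hxy, rfl⟩, hmin⟩ := hparam
  obtain ⟨σ, hpow⟩ := exists_ringHom_pow hq hF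
  have hσ : Function.Involutive σ := fun t => by rw [hpow, hpow, pow_pow_eq_self hF]
  obtain ⟨α, hα⟩ := exists_pow_ne hF hq.two_le
  rw [← hpow] at hα
  have hN : ∀ t, t ≠ 0 → σ t = t → ∃ s, s * σ s = t := fun t ht htq => by
    rw [hpow] at htq
    simpa only [hpow] using exists_mul_pow_eq hF hq.two_le ht htq
  have hD : ∀ x ∈ C, (∀ y ∈ C, hermForm σ y x = 0) → x = 0 := fun x hx h => by
    have : x ∈ C ⊓ hermitianDual q C := ⟨hx, fun y hy => by
      simpa only [hermForm_apply, hpow] using h y hy⟩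
    rwa [hLCD] at this
  obtain ⟨c, hc, U, hUU, hUC, hCU⟩ := exists_unitary_splitting hσ hα hN C hD
  obtain rfl : c = n - Module.finrank F C := by omega
  obtain ⟨co, h0, hco⟩ := exists_coordinates hσ hα
  have hcard : Nat.card (fixedSubfield σ) = q := by
    have h := Nat.card_congr co
    rw [Nat.card_prod, Nat.card_eq_fintype_card, hF, ← sq] at h
    exact (Nat.pow_left_injective two_ne_zero h).symm
  let e : Fin q ≃ fixedSubfield σ := (Finite.equivFinOfCardEq hcard).symm
  obtain ⟨ψ, hψ1⟩ := AddChar.exists_apply_ne_zero.2 (one_ne_zero (α := fixedSubfield σ))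
  have hψ : ψ.IsPrimitive := AddChar.IsPrimitive.of_ne_one (AddChar.ne_one_iff.2 ⟨1, hψ1⟩)
  obtain ⟨W, hW, hWU⟩ := exists_encoder co e hψ U fun p p' => Subtype.ext (by
    push_cast
    simp only [coe_commForm co hco, hUU]
    ring)
  let Q : EAQuantumCode q n (Module.finrank F C) (n - Module.finrank F C) := ⟨W, hW⟩
  refine ⟨Q, ⟨?_, ?_⟩, hc⟩
  -- The difference of two closest codewords is a codeword whose Weyl operator is an undetected
  -- error on exactly its support.
  · obtain ⟨a, ha⟩ := hCU (x - y) (C.sub_mem hx hy)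
    refine ⟨Finset.univ.filter fun i => (x - y) i ≠ 0, ?_, vectorWeyl co e ψ (U (a, 0)),
      weyl_actsOnlyOn e ψ (fun i hi => ?_) (fun i hi => ?_),
      Q.not_detects_vectorWeyl h0 e hψ hWU fun h => ?_⟩
    · simp [hammingDist, sub_eq_zero]
    · rw [ha, (by simpa using hi : (x - y) i = 0), h0]
      rfl
    · rw [ha, (by simpa using hi : (x - y) i = 0), h0]
      rfl
    · rw [h, Prod.mk_zero_zero, map_zero] at ha
      exact hxy (sub_eq_zero.1 ha.symm)
  · rintro w ⟨S, rfl, E, hE, hndet⟩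
    by_contra! hlt
    refine hndet (Q.detects_of_actsOnlyOn h0 e hψ hWU
      (exists_extension_vanishing hσ U hUU fun a ha => ?_) hE)
    by_contra ha0
    have hne : U (a, 0) ≠ 0 := fun h => ha0 (congrArg Prod.fst (U.map_eq_zero_iff.1 h))
    -- A nonzero codeword supported in `S` would lie closer to `0` than the minimum distance allows.
    refine absurd (hmin ⟨_, hUC a, 0, C.zero_mem, hne, rfl⟩) (not_le.2 (lt_of_le_of_lt ?_ hlt))
    rw [hammingDist_zero_right, hammingNorm]
    refine Finset.card_le_card fun i hi => ?_
    by_contra hiS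
    exact (Finset.mem_filter.1 hi).2 (ha i hiS)
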